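/- Let $\mu$ be a nonnegative Borel measure on $\mathbb{R}$ whose support is contained in $\mathbb{R}_+=[0,\infty)$ and all of whose moments $m_n=\int_{\mathbb{R}}x^n\,\mu(dx)$, $n=0,1,2,\dots$, are finite. If $$\sum_{n=1}^\infty \frac{1}{\sqrt[2n]{m_n}}=\infty$$ (with the convention $1/0=\infty$), then $\mu$ is the unique nonnegative Borel measure on $\mathbb{R}$ with support contained in $\mathbb{R}_+$, with finite moments of all orders, and with moment sequence $(m_n)_{n\ge 0}$. -/

import Mathlib

open MeasureTheory
open scoped ENNReal

/-- The nonnegative Borel measures on `ℝ` with finite moments of all orders whose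
(topological) support is contained in `K`. -/
def momentMeasures (K : Set ℝ) : Set (Measure ℝ) :=
  {μ | (∀ n : ℕ, Integrable (fun x : ℝ => x ^ n) μ) ∧ μ.support ⊆ K}

/-- The solutions of the full `K`-moment problem for the sequence `m`: the measures supported
in `K`, with finite moments of all orders, whose `n`-th moment is `m n` for every `n`. -/
def realizingMeasures (K : Set ℝ) (m : ℕ → ℝ) : Set (Measure ℝ) :=
  {μ | μ ∈ momentMeasures K ∧ ∀ n : ℕ, ∫ x : ℝ, x ^ n ∂μ = m n}

/-- Stieltjes' condition `∑_{n ≥ 1} 1 / m_n ^ (1 / (2 n)) = ∞` for a sequence of nonnegative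
numbers. The series is summed in `[0, ∞]`, where `1 / 0 = ∞`; its summation index starts at `0`,
hence the shift by one. -/
def StieltjesCondition (m : ℕ → ℝ) : Prop :=
  ∑' n : ℕ, 1 / ENNReal.ofReal (m (n + 1)) ^ (1 / (2 * ((n : ℝ) + 1))) = ∞

/-! Taking square roots with a random sign turns `μ` into a symmetric measure on the line with
vanishing odd moments and `2n`-th moment `m n`; squaring recovers `μ`. Stieltjes' condition thus
becomes Carleman's condition on the even moments, and it suffices to prove uniqueness on the whole
line (`eq_of_moments_eq_of_carleman`).

There, if `ν` and `ν'` have the same moments, the difference of their characteristic functions is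
flat at `0`, and its `j`-th derivative is bounded by `M j`, the `j`-th absolute moment of `ν + ν'`,
a log-convex sequence. Carleman's inequality shows that `∑ M j / M (j + 1)` diverges, and the
Denjoy–Carleman theorem, by Bang's argument, makes the difference vanish. -/

/-! ### Bang's proof of the Denjoy–Carleman theorem -/

/-- Gronwall-type propagation of bounds along a chain of derivatives. -/
theorem norm_le_mul_exp_of_hasDerivAt_chain {E : Type*} [NormedAddCommGroup E] [NormedSpace ℝ E]
    {g : ℕ → ℝ → E} (hg : ∀ j x, HasDerivAt (g j) (g (j + 1) x) x) {M : ℕ → ℝ}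
    (hM : ∀ j, 0 < M j) {N : ℕ} {K A a : ℝ} (hK : 0 ≤ K) (hA : 0 ≤ A)
    (hMA : ∀ j < N, M (j + 1) ≤ A * M j)
    (ha : ∀ j ≤ N, ‖g j a‖ ≤ K * Real.exp 1 ^ j * M j)
    (htop : ∀ x, ‖g N x‖ ≤ K * Real.exp 1 ^ N * M N) {j : ℕ} (hj : j ≤ N) {x : ℝ} (hx : a ≤ x) :
    ‖g j x‖ ≤ K * Real.exp 1 ^ j * M j * Real.exp (Real.exp 1 * A * (x - a)) := by
  induction hj using Nat.decreasingInduction generalizing x with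
  | self =>
    refine (htop x).trans (le_mul_of_one_le_right ?_ (Real.one_le_exp ?_))
    · have := hM N
      positivity
    · have := sub_nonneg.2 hx
      positivity
  | of_succ j hj ih =>
    -- The derivative of this majorant dominates the bound already known for `g (j + 1)`, because `M
    -- (j + 1) ≤ A * M j`.
    have hB : ∀ s, HasDerivAt
        (fun s => K * Real.exp 1 ^ j * M j * Real.exp (Real.exp 1 * A * (s - a)))
        (K * Real.exp 1 ^ j * M j * (Real.exp (Real.exp 1 * A * (s - a)) * (Real.exp 1 * A))) s := by
      intro s
      have h := ((hasDerivAt_id s).sub_const a).const_mul (Real.exp 1 * A)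
      simp only [id, mul_one] at h
      exact h.exp.const_mul _
    refine image_norm_le_of_norm_deriv_right_le_deriv_boundary
      (f := g j) (f' := g (j + 1)) (a := a) (b := x)
      (fun s _ => (hg j s).continuousAt.continuousWithinAt)
      (fun s _ => (hg j s).hasDerivWithinAt) ?_ hB ?_ (Set.right_mem_Icc.2 hx)
    · simpa using ha j hj.le
    · intro s hs
      refine (ih hs.1).trans ?_
      have h1 := mul_le_mul_of_nonneg_left (hMA j hj)
        (show 0 ≤ K * Real.exp 1 ^ (j + 1) * Real.exp (Real.exp 1 * A * (s - a)) by positivity)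
      calc _ = K * Real.exp 1 ^ (j + 1) * Real.exp (Real.exp 1 * A * (s - a)) * M (j + 1) := by ring
        _ ≤ _ := h1
        _ = _ := by ring

/-- The ratios `M (j + 1) / M j` of a log-convex sequence are increasing. -/
theorem monotone_ratio_of_sq_le {M : ℕ → ℝ} (hM : ∀ j, 0 < M j)
    (hlc : ∀ j, M (j + 1) ^ 2 ≤ M j * M (j + 2)) : Monotone fun j => M (j + 1) / M j := by
  refine monotone_nat_of_le_succ fun j => ?_
  rw [div_le_div_iff₀ (hM _) (hM _)]
  linarith [hlc j, sq (M (j + 1)), mul_comm (M j) (M (j + 2))]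

/-- Bang's estimate: near a point where a function is flat, it and its derivatives are small. -/
theorem norm_le_of_le_sum_ratio {E : Type*} [NormedAddCommGroup E] [NormedSpace ℝ E]
    {g : ℕ → ℝ → E} (hg : ∀ j x, HasDerivAt (g j) (g (j + 1) x) x) {M : ℕ → ℝ}
    (hM : ∀ j, 0 < M j) (hlc : ∀ j, M (j + 1) ^ 2 ≤ M j * M (j + 2))
    (hgM : ∀ j x, ‖g j x‖ ≤ M j) (h0 : ∀ j, g j 0 = 0) (d k : ℕ) {x : ℝ} (hx : 0 ≤ x)
    (hxs : x ≤ Real.exp (-1) * ∑ i ∈ Finset.range d, M (k + i) / M (k + i + 1)) (j : ℕ) :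
    ‖g j x‖ ≤ Real.exp (-1) ^ k * Real.exp 1 ^ j * M j := by
  have hee : Real.exp (-1) * Real.exp 1 = 1 := by rw [← Real.exp_add]; simp
  have htriv : ∀ k j x, k ≤ j → ‖g j x‖ ≤ Real.exp (-1) ^ k * Real.exp 1 ^ j * M j := by
    intro k j x hkj
    refine (hgM j x).trans (le_mul_of_one_le_left (hM j).le ?_)
    obtain ⟨l, rfl⟩ := Nat.exists_eq_add_of_le hkj
    rw [pow_add, ← mul_assoc, ← mul_pow, hee, one_pow, one_mul]
    exact one_le_pow₀ (Real.one_le_exp zero_le_one)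
  induction d generalizing k x j with
  | zero =>
    have : x = 0 := le_antisymm (by simpa using hxs) hx
    rw [this, h0, norm_zero]
    have := hM j
    positivity
  | succ d ih =>
    -- Up to `y` the induction hypothesis gives the better factor `e⁻¹ ^ (k + 1)`; the remaining
    -- interval has length at most `e⁻¹ * M k / M (k + 1)`.
    set y := Real.exp (-1) * ∑ i ∈ Finset.range d, M (k + 1 + i) / M (k + 1 + i + 1) with hy
    have hy0 : 0 ≤ y := by
      refine mul_nonneg (Real.exp_pos _).le (Finset.sum_nonneg fun i _ => ?_)
      exact (div_pos (hM _) (hM _)).le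
    have hxy : x ≤ y + Real.exp (-1) * (M k / M (k + 1)) := by
      refine hxs.trans_eq ?_
      rw [Finset.sum_range_succ', hy, mul_add]
      congr 2
      refine Finset.sum_congr rfl fun i _ => ?_
      rw [show k + (i + 1) = k + 1 + i by ring]
    rcases le_or_gt k j with hkj | hjk
    · exact htriv k j x hkj
    rcases le_total x y with hle | hle
    · refine (ih (k + 1) hx hle j).trans ?_
      have := hM j
      gcongr ?_ * _ * _
      exact pow_le_pow_of_le_one (Real.exp_pos _).le (Real.exp_le_one_iff.2 (by norm_num))
        (Nat.le_succ k)
    · have hmono := monotone_ratio_of_sq_le hM hlc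
      have h := norm_le_mul_exp_of_hasDerivAt_chain hg hM (N := k + 1) (a := y)
        (K := Real.exp (-1) ^ (k + 1)) (A := M (k + 1) / M k) (by positivity)
        (div_pos (hM _) (hM _)).le
        (fun i hi => (div_le_iff₀ (hM i)).1 (hmono (Nat.lt_succ_iff.1 hi)))
        (fun i _ => ih (k + 1) hy0 le_rfl i) (fun s => htriv _ _ s le_rfl)
        (hjk.le.trans (Nat.le_succ k)) hle
      -- Crossing the last interval costs at most a factor `e`, so exactly one of the `k + 1`
      -- factors `e⁻¹` is lost.
      have hexp : Real.exp (Real.exp 1 * (M (k + 1) / M k) * (x - y)) ≤ Real.exp 1 := by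
        refine Real.exp_le_exp.2 ?_
        have hpos : 0 ≤ Real.exp 1 * (M (k + 1) / M k) :=
          mul_nonneg (Real.exp_pos _).le (div_pos (hM _) (hM _)).le
        refine (mul_le_mul_of_nonneg_left (sub_le_iff_le_add'.2 hxy) hpos).trans_eq ?_
        have h1 := (hM k).ne'
        have h2 := (hM (k + 1)).ne'
        calc _ = (Real.exp (-1) * Real.exp 1) * ((M (k + 1) / M k) * (M k / M (k + 1))) := by ring
          _ = 1 := by rw [hee, one_mul]; field_simp
      have := hM j
      refine (h.trans (mul_le_mul_of_nonneg_left hexp (by positivity))).trans_eq ?_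
      calc _ = Real.exp (-1) ^ k * Real.exp 1 ^ j * M j * (Real.exp (-1) * Real.exp 1) := by ring
        _ = _ := by rw [hee, mul_one]

/-- The Denjoy–Carleman theorem on a half-line: a function which is flat at `0` and lies in a
quasi-analytic class vanishes. Here `g j` is the `j`-th derivative of `g 0`. -/
theorem eq_zero_of_flat_of_not_summable {E : Type*} [NormedAddCommGroup E] [NormedSpace ℝ E]
    {g : ℕ → ℝ → E} (hg : ∀ j x, HasDerivAt (g j) (g (j + 1) x) x) {M : ℕ → ℝ}
    (hM : ∀ j, 0 < M j) (hlc : ∀ j, M (j + 1) ^ 2 ≤ M j * M (j + 2))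
    (hgM : ∀ j x, ‖g j x‖ ≤ M j) (h0 : ∀ j, g j 0 = 0)
    (hdiv : ¬ Summable fun j => M j / M (j + 1)) {x : ℝ} (hx : 0 ≤ x) : g 0 x = 0 := by
  have hk : ∀ k, ‖g 0 x‖ ≤ Real.exp (-1) ^ k * M 0 := by
    intro k
    have hdiv' : ¬ Summable fun i => M (k + i) / M (k + i + 1) := by
      rw [← summable_nat_add_iff k] at hdiv
      simpa only [add_comm k] using hdiv
    have ht := (not_summable_iff_tendsto_nat_atTop_of_nonneg
      (fun i => (div_pos (hM _) (hM _)).le)).1 hdiv'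
    obtain ⟨d, hd⟩ := (ht.eventually_ge_atTop (Real.exp 1 * x)).exists
    have h := norm_le_of_le_sum_ratio hg hM hlc hgM h0 d k hx ?_ 0
    · simpa using h
    · refine le_trans (le_of_eq ?_) (mul_le_mul_of_nonneg_left hd (Real.exp_pos (-1)).le)
      rw [← mul_assoc, ← Real.exp_add]
      simp
  have hlim : Filter.Tendsto (fun k : ℕ => Real.exp (-1) ^ k * M 0) Filter.atTop (nhds (0 * M 0)) :=
    (tendsto_pow_atTop_nhds_zero_of_lt_one (Real.exp_pos _).le
      (Real.exp_lt_one_iff.2 (by norm_num))).mul_const _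
  rw [zero_mul] at hlim
  exact norm_le_zero_iff.1 (ge_of_tendsto' hlim hk)

/-! ### Carleman's inequality -/

/-- A geometric mean is controlled by a weighted arithmetic mean. -/
theorem prod_rpow_le_exp_mul_sum {a : ℕ → ℝ} (ha : ∀ j, 0 ≤ a j) (n : ℕ) :
    (∏ j ∈ Finset.range (n + 1), a j) ^ (1 / ((n : ℝ) + 1)) ≤
      Real.exp 1 * ((∑ j ∈ Finset.range (n + 1), ((j : ℝ) + 1) * a j) / ((n : ℝ) + 1) ^ 2) := by
  have hn : (0 : ℝ) < (n : ℝ) + 1 := by positivity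
  have hagm := Real.geom_mean_le_arith_mean_weighted (Finset.range (n + 1))
    (fun _ => 1 / ((n : ℝ) + 1)) (fun j => ((j : ℝ) + 1) * a j) (fun _ _ => by positivity)
    (by simp; field_simp) (fun j _ => mul_nonneg (by positivity) (ha j))
  have hprod0 : 0 ≤ ∏ j ∈ Finset.range (n + 1), a j := Finset.prod_nonneg fun j _ => ha j
  have hfac : (∏ j ∈ Finset.range (n + 1), ((j : ℝ) + 1)) = ((n + 1).factorial : ℝ) := by
    rw [← Finset.prod_range_add_one_eq_factorial]
    push_cast
    rfl
  rw [Real.finsetProd_rpow _ _ (fun j _ => mul_nonneg (by positivity) (ha j)),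
    Finset.prod_mul_distrib, hfac, Real.mul_rpow (by positivity) hprod0, ← Finset.mul_sum] at hagm
  -- The weights `j + 1` multiply to `(n + 1)!`; this Stirling-type bound comes from one term of the
  -- series of `exp (n + 1)`.
  have hstir : ((n : ℝ) + 1) * Real.exp (-1) ≤
      ((n + 1).factorial : ℝ) ^ (1 / ((n : ℝ) + 1)) := by
    rw [one_div, Real.le_rpow_inv_iff_of_pos (by positivity) (by positivity) hn]
    have h := Real.pow_div_factorial_le_exp (x := (n : ℝ) + 1) (by positivity) (n + 1)
    rw [div_le_iff₀ (by positivity)] at h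
    have hcast : (n : ℝ) + 1 = ((n + 1 : ℕ) : ℝ) := by push_cast; rfl
    have hexp : Real.exp ((n : ℝ) + 1) * Real.exp (-1) ^ (n + 1) = 1 := by
      rw [← Real.exp_nat_mul, ← Real.exp_add]
      simp
    calc _ = (((n : ℝ) + 1) * Real.exp (-1)) ^ (n + 1) := by rw [hcast, Real.rpow_natCast]
      _ = ((n : ℝ) + 1) ^ (n + 1) * Real.exp (-1) ^ (n + 1) := mul_pow _ _ _
      _ ≤ Real.exp ((n : ℝ) + 1) * ((n + 1).factorial : ℝ) * Real.exp (-1) ^ (n + 1) := by gcongr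
      _ = ((n + 1).factorial : ℝ) := by linear_combination ((n + 1).factorial : ℝ) * hexp
  have hP : 0 ≤ (∏ j ∈ Finset.range (n + 1), a j) ^ (1 / ((n : ℝ) + 1)) := by positivity
  have h := (mul_le_mul_of_nonneg_right hstir hP).trans hagm
  have hee : Real.exp (-1) * Real.exp 1 = 1 := by rw [← Real.exp_add]; simp
  calc _ = (Real.exp 1 / ((n : ℝ) + 1)) * (((n : ℝ) + 1) * Real.exp (-1) *
        (∏ j ∈ Finset.range (n + 1), a j) ^ (1 / ((n : ℝ) + 1))) := by
        field_simp
        rw [mul_assoc, mul_comm (Real.exp 1), hee, mul_one]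
    _ ≤ _ := mul_le_mul_of_nonneg_left h (by positivity)
    _ = _ := by field_simp

/-- Carleman's inequality, up to the value of the constant. -/
theorem summable_prod_rpow {a : ℕ → ℝ} (ha : ∀ j, 0 ≤ a j) (hs : Summable a) :
    Summable fun n : ℕ => (∏ j ∈ Finset.range (n + 1), a j) ^ (1 / ((n : ℝ) + 1)) := by
  set T : ℕ → ℝ := fun n => ∑ j ∈ Finset.range n, ((j : ℝ) + 1) * a j with hT
  have hT0 : ∀ n, 0 ≤ T n := fun n =>
    Finset.sum_nonneg fun j _ => mul_nonneg (by positivity) (ha j)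
  -- Summation by parts with `1 / (n + 1) ^ 2 ≤ 2 / (n + 1) - 2 / (n + 2)`; the extra term is the
  -- boundary term that lets the induction close.
  have key : ∀ N : ℕ, ∑ n ∈ Finset.range N, T (n + 1) / ((n : ℝ) + 1) ^ 2 + 2 * T N / ((N : ℝ) + 1)
      ≤ 2 * ∑ j ∈ Finset.range N, a j := by
    intro N
    induction N with
    | zero => simp [hT]
    | succ N ih =>
      rw [Finset.sum_range_succ, Finset.sum_range_succ]
      have h1 : T (N + 1) / ((N : ℝ) + 1) ^ 2 + 2 * T (N + 1) / (((N + 1 : ℕ) : ℝ) + 1) ≤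
          2 * T (N + 1) / ((N : ℝ) + 1) := by
        have := hT0 (N + 1)
        push_cast
        rw [div_add_div _ _ (by positivity) (by positivity),
          div_le_div_iff₀ (by positivity) (by positivity)]
        have h2 : 0 ≤ T (N + 1) * (((N : ℝ) + 1) * N) := by positivity
        have h3 : 0 ≤ T (N + 1) * (((N : ℝ) + 1) * N) * (N + 1) := by positivity
        nlinarith
      have h2 : 2 * T (N + 1) / ((N : ℝ) + 1) = 2 * T N / ((N : ℝ) + 1) + 2 * a N := by
        simp only [hT, Finset.sum_range_succ]
        field_simp
      linarith
  have hsum : Summable fun n : ℕ => T (n + 1) / ((n : ℝ) + 1) ^ 2 := by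
    refine summable_of_sum_range_le (c := 2 * ∑' j, a j)
      (fun n => div_nonneg (hT0 _) (by positivity)) fun N => ?_
    have h1 := hs.sum_le_tsum (Finset.range N) fun j _ => ha j
    have h2 : 0 ≤ 2 * T N / ((N : ℝ) + 1) := by
      have := hT0 N
      positivity
    linarith [key N]
  exact Summable.of_nonneg_of_le
    (fun n => Real.rpow_nonneg (Finset.prod_nonneg fun j _ => ha j) _)
    (prod_rpow_le_exp_mul_sum ha) (hsum.mul_left _)

/-! ### Absolute moments and characteristic functions -/

theorem integrable_abs_pow {ρ : Measure ℝ} (hint : ∀ k : ℕ, Integrable (fun y : ℝ => y ^ k) ρ)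
    (k : ℕ) : Integrable (fun y : ℝ => |y| ^ k) ρ := by
  simpa only [abs_pow] using (hint k).abs

/-- Absolute moments are log-convex. -/
theorem sq_integral_abs_pow_le {ρ : Measure ℝ} (hint : ∀ k : ℕ, Integrable (fun y : ℝ => y ^ k) ρ)
    (k : ℕ) :
    (∫ y, |y| ^ (k + 1) ∂ρ) ^ 2 ≤ (∫ y, |y| ^ k ∂ρ) * ∫ y, |y| ^ (k + 2) ∂ρ := by
  have hi := integrable_abs_pow hint
  -- The quadratic is the integral of `|y| ^ k * (s * |y| - 1) ^ 2`, so its discriminant is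
  -- nonpositive.
  have h : ∀ s : ℝ, 0 ≤ (∫ y, |y| ^ (k + 2) ∂ρ) * (s * s) +
      (-2 * ∫ y, |y| ^ (k + 1) ∂ρ) * s + ∫ y, |y| ^ k ∂ρ := by
    intro s
    have heq : (∫ y, |y| ^ k * (s * |y| - 1) ^ 2 ∂ρ) =
        (∫ y, |y| ^ (k + 2) ∂ρ) * (s * s) + (-2 * ∫ y, |y| ^ (k + 1) ∂ρ) * s +
          ∫ y, |y| ^ k ∂ρ := by
      have hfun : (fun y : ℝ => |y| ^ k * (s * |y| - 1) ^ 2) = fun y : ℝ =>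
          (s * s) * |y| ^ (k + 2) + (-2 * s) * |y| ^ (k + 1) + |y| ^ k := by
        funext y
        ring
      have h2 := (hi (k + 2)).const_mul (s * s)
      have h1 := (hi (k + 1)).const_mul (-2 * s)
      have h21 : Integrable (fun y : ℝ => (s * s) * |y| ^ (k + 2) + (-2 * s) * |y| ^ (k + 1)) ρ :=
        h2.add h1
      rw [hfun, integral_add h21 (hi k), integral_add h2 h1, integral_const_mul,
        integral_const_mul]
      ring
    rw [← heq]
    exact integral_nonneg fun y => by positivity
  have hd := discrim_le_zero h
  rw [discrim] at hd
  linarith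

theorem integral_abs_pow_pos {ρ : Measure ℝ} (hint : ∀ k : ℕ, Integrable (fun y : ℝ => y ^ k) ρ)
    (h0 : ¬ ∀ᵐ y ∂ρ, y = 0) (k : ℕ) : 0 < ∫ y, |y| ^ k ∂ρ := by
  refine lt_of_le_of_ne (integral_nonneg fun y => by positivity) fun h => h0 ?_
  filter_upwards [(integral_eq_zero_iff_of_nonneg (fun y => by positivity)
    (integrable_abs_pow hint k)).1 h.symm] with y hy
  exact abs_eq_zero.1 (eq_zero_of_pow_eq_zero (n := k) hy)

theorem memLp_id_of_integrable_pow {ρ : Measure ℝ}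
    (hint : ∀ k : ℕ, Integrable (fun y : ℝ => y ^ k) ρ) (k : ℕ) : MemLp id k ρ := by
  rcases eq_or_ne k 0 with rfl | hk
  · simpa using by fun_prop
  · rw [← integrable_norm_rpow_iff (by fun_prop) (by exact_mod_cast hk) (by simp)]
    simpa using integrable_abs_pow hint k

theorem norm_iteratedDeriv_charFun_le {ρ : Measure ℝ} [IsFiniteMeasure ρ]
    (hint : ∀ k : ℕ, Integrable (fun y : ℝ => y ^ k) ρ) (k : ℕ) (t : ℝ) :
    ‖iteratedDeriv k (charFun ρ) t‖ ≤ ∫ y, |y| ^ k ∂ρ := by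
  rw [iteratedDeriv_charFun (memLp_id_of_integrable_pow hint k), norm_mul, norm_pow,
    Complex.norm_I, one_pow, one_mul]
  refine (norm_integral_le_integral_norm _).trans_eq ?_
  congr 1
  funext y
  rw [norm_mul, norm_pow, Complex.norm_real, Real.norm_eq_abs, ← Complex.ofReal_mul,
    Complex.norm_exp_ofReal_mul_I, mul_one]

/-! ### Carleman's theorem on the line -/

/-- Carleman's condition on the even moments forces the ratios of consecutive terms of a positive
sequence, proportional to these moments at even indices, to have divergent sum. -/
theorem not_summable_ratio_of_carleman {M s : ℕ → ℝ} (hM : ∀ j, 0 < M j)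
    (hs : ∀ n, M (2 * n) = 2 * s n) (hc : StieltjesCondition s) :
    ¬ Summable fun j => M j / M (j + 1) := by
  intro hsum
  have hspos : ∀ n, 0 < s n := fun n => by linarith [hM (2 * n), hs n]
  have hprod : ∀ n, ∏ j ∈ Finset.range n, M j / M (j + 1) = M 0 / M n := by
    intro n
    induction n with
    | zero => simp [(hM 0).ne']
    | succ n ih =>
      rw [Finset.prod_range_succ, ih]
      have := (hM n).ne'
      field_simp
  -- At index `2 * n + 1` the product of ratios telescopes to `M 0 / M (2 * n + 2)`, which involves
  -- an even moment only.
  have h1 := (summable_prod_rpow (fun j => (div_pos (hM j) (hM (j + 1))).le) hsum).comp_injective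
    (i := fun n : ℕ => 2 * n + 1) (fun a b h => by simpa using h)
  set f : ℕ → ℝ := fun n => 1 / s (n + 1) ^ (1 / (2 * ((n : ℝ) + 1))) with hf
  have hf0 : ∀ n, 0 ≤ f n := fun n => by
    have := hspos (n + 1)
    positivity
  -- `min 1 (s 0)` bounds every root `s 0 ^ (1 / (2 * (n + 1)))` from below.
  have h2 : Summable fun n => min 1 (s 0) * f n := by
    refine Summable.of_nonneg_of_le
      (fun n => mul_nonneg (le_min zero_le_one (hspos 0).le) (hf0 n)) (fun n => ?_) h1
    have hexp : 1 / (((2 * n + 1 : ℕ) : ℝ) + 1) = 1 / (2 * ((n : ℝ) + 1)) := by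
      push_cast
      ring
    have hratio : M 0 / M (2 * n + 1 + 1) = s 0 / s (n + 1) := by
      rw [show 2 * n + 1 + 1 = 2 * (n + 1) by ring, hs, show M 0 = 2 * s 0 from hs 0,
        mul_div_mul_left _ _ two_ne_zero]
    simp only [Function.comp_apply]
    rw [hprod, hexp, hratio, Real.div_rpow (hspos 0).le (hspos _).le, hf, mul_one_div]
    have hpos : 0 < s (n + 1) ^ (1 / (2 * ((n : ℝ) + 1))) := Real.rpow_pos_of_pos (hspos _) _
    gcongr
    rcases le_total 1 (s 0) with h | h
    · exact (min_le_left _ _).trans (Real.one_le_rpow h (by positivity))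
    · refine (min_le_right _ _).trans (Real.self_le_rpow_of_le_one (hspos 0).le h ?_)
      rw [div_le_one (by positivity)]
      have : (0 : ℝ) ≤ n := Nat.cast_nonneg n
      linarith
  have h3 : Summable f :=
    (summable_mul_left_iff (lt_min zero_lt_one (hspos 0)).ne').1 h2
  have h4 : ∑' n, ENNReal.ofReal (f n) = ∞ := by
    rw [← hc]
    refine tsum_congr fun n => ?_
    rw [hf, ENNReal.ofReal_div_of_pos (Real.rpow_pos_of_pos (hspos _) _), ENNReal.ofReal_one,
      ENNReal.ofReal_rpow_of_pos (hspos _)]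
  rw [← ENNReal.ofReal_tsum_of_nonneg hf0 h3] at h4
  exact ENNReal.ofReal_ne_top h4

/-- Carleman's uniqueness theorem for the moment problem on the whole line. -/
theorem eq_of_moments_eq_of_carleman {ν ν' : Measure ℝ} [IsFiniteMeasure ν] [IsFiniteMeasure ν']
    (hν : ∀ k : ℕ, Integrable (fun y : ℝ => y ^ k) ν)
    (hν' : ∀ k : ℕ, Integrable (fun y : ℝ => y ^ k) ν')
    (hmom : ∀ k : ℕ, ∫ y, y ^ k ∂ν = ∫ y, y ^ k ∂ν')
    (hc : StieltjesCondition fun n => ∫ y, y ^ (2 * n) ∂ν) : ν = ν' := by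
  refine Measure.ext_of_charFun (funext fun t => ?_)
  have hint : ∀ k : ℕ, Integrable (fun y : ℝ => y ^ k) (ν + ν') := fun k =>
    (hν k).add_measure (hν' k)
  -- If both measures sit at `0`, the higher `M k` vanish and ratios are useless, but both
  -- characteristic functions are constant, equal to the total mass.
  by_cases h0 : ∀ᵐ y ∂(ν + ν'), y = 0
  · rw [ae_add_measure_iff] at h0
    have hconst : ∀ {ρ : Measure ℝ}, (∀ᵐ y ∂ρ, y = 0) →
        charFun ρ t = ((∫ y, y ^ 0 ∂ρ : ℝ) : ℂ) := by
      intro ρ hρ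
      rw [charFun_apply_real, ← integral_complex_ofReal]
      refine integral_congr_ae ?_
      filter_upwards [hρ] with y hy
      simp [hy]
    rw [hconst h0.1, hconst h0.2, hmom 0]
  · set M : ℕ → ℝ := fun k => ∫ y, |y| ^ k ∂(ν + ν') with hMdef
    have hM : ∀ k, 0 < M k := integral_abs_pow_pos hint h0
    have hMadd : ∀ k, M k = (∫ y, |y| ^ k ∂ν) + ∫ y, |y| ^ k ∂ν' := fun k =>
      integral_add_measure (integrable_abs_pow hν k) (integrable_abs_pow hν' k)
    have heven : ∀ n, M (2 * n) = 2 * ∫ y, y ^ (2 * n) ∂ν := by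
      intro n
      have h : ∀ y : ℝ, |y| ^ (2 * n) = y ^ (2 * n) := fun y => (even_two_mul n).pow_abs y
      rw [hMadd]
      simp only [h]
      rw [← hmom, ← two_mul]
    have hdiff : ∀ {ρ : Measure ℝ} [IsFiniteMeasure ρ],
        (∀ k : ℕ, Integrable (fun y : ℝ => y ^ k) ρ) → ∀ j x,
          HasDerivAt (iteratedDeriv j (charFun ρ)) (iteratedDeriv (j + 1) (charFun ρ) x) x := by
      intro ρ _ hρ j x
      rw [iteratedDeriv_succ]
      have hcd : ContDiff ℝ ((⊤ : ℕ∞) : WithTop ℕ∞) (charFun ρ) :=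
        contDiff_charFun' (memLp_id_of_integrable_pow hρ)
      exact (hcd.differentiable_iteratedDeriv j (by exact_mod_cast ENat.natCast_lt_top j) x).hasDerivAt
    have key : ∀ x, 0 ≤ x → charFun ν x = charFun ν' x := by
      intro x hx
      have h := eq_zero_of_flat_of_not_summable
        (g := fun j x => iteratedDeriv j (charFun ν) x - iteratedDeriv j (charFun ν') x)
        (fun j x => (hdiff hν j x).sub (hdiff hν' j x)) hM (sq_integral_abs_pow_le hint)
        (fun j x => ?_) (fun j => ?_) (not_summable_ratio_of_carleman hM heven hc) hx
      · simpa [sub_eq_zero] using h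
      · rw [hMadd]
        exact (norm_sub_le _ _).trans (add_le_add (norm_iteratedDeriv_charFun_le hν j x)
          (norm_iteratedDeriv_charFun_le hν' j x))
      · rw [iteratedDeriv_charFun_zero (memLp_id_of_integrable_pow hν j),
          iteratedDeriv_charFun_zero (memLp_id_of_integrable_pow hν' j), hmom, sub_self]
    rcases le_total 0 t with ht | ht
    · exact key t ht
    · rw [← neg_neg t, charFun_neg, charFun_neg (-t), key _ (neg_nonneg.2 ht)]

/-! ### Symmetrisation -/

/-- The symmetric measure on `ℝ` whose image under squaring is `μ`. -/
noncomputable def symmetricSqrt (μ : Measure ℝ) : Measure ℝ :=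
  (2⁻¹ : ℝ≥0∞) • (μ.map (fun x => √x) + μ.map (fun x => -√x))

theorem ae_nonneg_of_mem_momentMeasures {μ : Measure ℝ} (hμ : μ ∈ momentMeasures (Set.Ici 0)) :
    ∀ᵐ x ∂μ, 0 ≤ x := by
  filter_upwards [Measure.support_mem_ae (μ := μ)] with x hx
  exact hμ.2 hx

theorem integrable_sqrt_pow {μ : Measure ℝ} (hμ : ∀ n : ℕ, Integrable (fun x : ℝ => x ^ n) μ)
    (k : ℕ) : Integrable (fun x : ℝ => √x ^ k) μ := by
  -- Majorant `1 + |x| ^ k`; for negative `x` the root is `0` by convention.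
  refine ((hμ 0).add (hμ k).abs).mono' (by fun_prop) (.of_forall fun x => ?_)
  rw [Real.norm_of_nonneg (by positivity)]
  simp only [pow_zero, Pi.add_apply, abs_pow]
  rcases le_total (√x) 1 with h | h
  · exact (pow_le_one₀ (Real.sqrt_nonneg x) h).trans (le_add_of_nonneg_right (by positivity))
  · refine (pow_le_pow_left₀ (Real.sqrt_nonneg x) ?_ k).trans (le_add_of_nonneg_left zero_le_one)
    rw [Real.one_le_sqrt] at h
    rw [abs_of_nonneg (zero_le_one.trans h), Real.sqrt_le_left (zero_le_one.trans h)]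
    exact le_self_pow₀ h two_ne_zero

theorem integrable_pow_map_sqrt {μ : Measure ℝ}
    (hμ : ∀ n : ℕ, Integrable (fun x : ℝ => x ^ n) μ) (k : ℕ) :
    Integrable (fun y : ℝ => y ^ k) (μ.map fun x => √x) := by
  rw [integrable_map_measure (by fun_prop) (by fun_prop)]
  exact integrable_sqrt_pow hμ k

theorem integrable_pow_map_neg_sqrt {μ : Measure ℝ}
    (hμ : ∀ n : ℕ, Integrable (fun x : ℝ => x ^ n) μ) (k : ℕ) :
    Integrable (fun y : ℝ => y ^ k) (μ.map fun x => -√x) := by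
  rw [integrable_map_measure (by fun_prop) (by fun_prop)]
  have h : ((fun y : ℝ => y ^ k) ∘ fun x => -√x) = fun x => (-1) ^ k * √x ^ k := by
    funext x
    exact neg_pow _ _
  rw [h]
  exact (integrable_sqrt_pow hμ k).const_mul _

theorem integrable_pow_symmetricSqrt {μ : Measure ℝ}
    (hμ : ∀ n : ℕ, Integrable (fun x : ℝ => x ^ n) μ) (k : ℕ) :
    Integrable (fun y : ℝ => y ^ k) (symmetricSqrt μ) :=
  ((integrable_pow_map_sqrt hμ k).add_measure (integrable_pow_map_neg_sqrt hμ k)).smul_measure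
    (by simp)

theorem integral_pow_symmetricSqrt {μ : Measure ℝ}
    (hμ : ∀ n : ℕ, Integrable (fun x : ℝ => x ^ n) μ) (k : ℕ) :
    ∫ y, y ^ k ∂(symmetricSqrt μ) = 2⁻¹ * ((1 + (-1) ^ k) * ∫ x, √x ^ k ∂μ) := by
  rw [symmetricSqrt, integral_smul_measure, integral_add_measure (integrable_pow_map_sqrt hμ k)
    (integrable_pow_map_neg_sqrt hμ k), integral_map (by fun_prop) (by fun_prop),
    integral_map (by fun_prop) (by fun_prop)]
  simp only [neg_pow (√_)]
  rw [integral_const_mul]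
  simp only [ENNReal.toReal_inv, ENNReal.toReal_ofNat, smul_eq_mul]
  ring

theorem integral_even_pow_symmetricSqrt {μ : Measure ℝ}
    (hμ : ∀ n : ℕ, Integrable (fun x : ℝ => x ^ n) μ) (h0 : ∀ᵐ x ∂μ, 0 ≤ x) (n : ℕ) :
    ∫ y, y ^ (2 * n) ∂(symmetricSqrt μ) = ∫ x, x ^ n ∂μ := by
  have h : ∫ x, √x ^ (2 * n) ∂μ = ∫ x, x ^ n ∂μ := by
    refine integral_congr_ae ?_
    filter_upwards [h0] with x hx
    simp only [pow_mul, Real.sq_sqrt hx]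
  rw [integral_pow_symmetricSqrt hμ, h, (even_two_mul n).neg_one_pow]
  ring

theorem integral_odd_pow_symmetricSqrt {μ : Measure ℝ}
    (hμ : ∀ n : ℕ, Integrable (fun x : ℝ => x ^ n) μ) {k : ℕ} (hk : Odd k) :
    ∫ y, y ^ k ∂(symmetricSqrt μ) = 0 := by
  rw [integral_pow_symmetricSqrt hμ, hk.neg_one_pow]
  ring

theorem map_sq_symmetricSqrt {μ : Measure ℝ} (h0 : ∀ᵐ x ∂μ, 0 ≤ x) :
    (symmetricSqrt μ).map (fun y => y ^ 2) = μ := by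
  have h1 : μ.map ((fun y => y ^ 2) ∘ fun x => √x) = μ := by
    conv_rhs => rw [← Measure.map_id (μ := μ)]
    refine Measure.map_congr ?_
    filter_upwards [h0] with x hx
    simp [Real.sq_sqrt hx]
  have h2 : ((fun y : ℝ => y ^ 2) ∘ fun x => -√x) = (fun y => y ^ 2) ∘ fun x => √x := by
    funext x
    simp
  rw [symmetricSqrt, Measure.map_smul, Measure.map_add _ _ (by fun_prop),
    Measure.map_map (by fun_prop) (by fun_prop), Measure.map_map (by fun_prop) (by fun_prop), h2,
    h1, ← two_smul ℝ≥0∞ μ, smul_smul, ENNReal.inv_mul_cancel two_ne_zero ENNReal.ofNat_ne_top,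
    one_smul]

theorem isFiniteMeasure_of_integrable_pow {ρ : Measure ℝ}
    (h : ∀ n : ℕ, Integrable (fun x : ℝ => x ^ n) ρ) : IsFiniteMeasure ρ := by
  have h0 := h 0
  simp only [pow_zero] at h0
  exact (integrable_const_iff_isFiniteMeasure one_ne_zero).1 h0

theorem theorem2p3 (m : ℕ → ℝ) (μ : Measure ℝ)
    (hμ : μ ∈ realizingMeasures (Set.Ici 0) m) (hm : StieltjesCondition m) :
    realizingMeasures (Set.Ici 0) m = {μ} := by
  refine Set.eq_singleton_iff_unique_mem.2 ⟨hμ, fun μ' hμ' => ?_⟩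
  have h0 := ae_nonneg_of_mem_momentMeasures hμ.1
  have h0' := ae_nonneg_of_mem_momentMeasures hμ'.1
  have hν := integrable_pow_symmetricSqrt hμ.1.1
  have hν' := integrable_pow_symmetricSqrt hμ'.1.1
  have := isFiniteMeasure_of_integrable_pow hν
  have := isFiniteMeasure_of_integrable_pow hν'
  have heq : symmetricSqrt μ = symmetricSqrt μ' := by
    refine eq_of_moments_eq_of_carleman hν hν' (fun k => ?_) ?_
    · rcases Nat.even_or_odd' k with ⟨n, rfl | rfl⟩
      · rw [integral_even_pow_symmetricSqrt hμ.1.1 h0, integral_even_pow_symmetricSqrt hμ'.1.1 h0',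
          hμ.2, hμ'.2]
      · rw [integral_odd_pow_symmetricSqrt hμ.1.1 (odd_two_mul_add_one n),
          integral_odd_pow_symmetricSqrt hμ'.1.1 (odd_two_mul_add_one n)]
    · simpa only [integral_even_pow_symmetricSqrt hμ.1.1 h0, hμ.2] using hm
  rw [← map_sq_symmetricSqrt h0, heq, map_sq_symmetricSqrt h0']
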